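/- Let $G$ be a group. Write $a^g=g^{-1}ag$ and $[x,y]=x^{-1}y^{-1}xy$. An element $a\in G$ is a *left $3$-Engel element* if $[[[x,a],a],a]=1$ for all $x\in G$. It is a *strong left $3$-Engel element* if $\langle a,a^g\rangle$ is nilpotent of class at most $2$ for all $g\in G$, and $\langle a,a^f,a^g\rangle$ is nilpotent of class at most $3$ for all $f,g\in G$. A group is *locally nilpotent* if all its finitely generated subgroups are nilpotent, and the *Hirsch–Plotkin radical* $\mathrm{HP}(G)$ is the product of all locally nilpotent normal subgroups of $G$. **Theorem.** If $a$ is a strong left $3$-Engel element of $G$, then its normal closure $\langle a\rangle^G$ in $G$ is locally nilpotent. In particular, every left $3$-Engel element of $G$ of (finite) odd order lies in $\mathrm{HP}(G)$. -/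

import Mathlib

namespace LeftEngel

/-- The conjugate `a ^ g = g⁻¹ a g`. -/
def groupConj {G : Type*} [Group G] (a g : G) : G := g⁻¹ * a * g

/-- The commutator `[x, y] = x⁻¹ y⁻¹ x y`. -/
def groupComm {G : Type*} [Group G] (x y : G) : G := x⁻¹ * y⁻¹ * x * y

/-- The left-normed iterated commutator `[x, a, …, a]` with `n` occurrences of `a`. -/
def iterComm {G : Type*} [Group G] (x a : G) : ℕ → G
  | 0 => x
  | n + 1 => groupComm (iterComm x a n) a

/-- `a` is a left `n`-Engel element of `G`. -/
def IsLeftEngel {G : Type*} [Group G] (n : ℕ) (a : G) : Prop :=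
  ∀ x : G, iterComm x a n = 1

/-- The group `G` is nilpotent of class at most `n`. -/
def NilpotentOfClassAtMost (n : ℕ) (G : Type*) [Group G] : Prop :=
  Group.IsNilpotent G ∧ Group.nilpotencyClass G ≤ n

/-- `a` is a strong left `3`-Engel element of `G`. -/
def IsStrongLeftThreeEngel {G : Type*} [Group G] (a : G) : Prop :=
  (∀ g : G, NilpotentOfClassAtMost 2 (Subgroup.closure {a, groupConj a g})) ∧
  (∀ f g : G, NilpotentOfClassAtMost 3 (Subgroup.closure {a, groupConj a f, groupConj a g}))

/-- The group `G` is locally nilpotent: its finitely generated subgroups are nilpotent. -/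
def IsLocallyNilpotent (G : Type*) [Group G] : Prop :=
  ∀ H : Subgroup G, H.FG → Group.IsNilpotent H

/-- The Hirsch–Plotkin radical: the product (i.e. the join in the lattice of subgroups) of all
locally nilpotent normal subgroups of `G`. -/
def hirschPlotkinRadical (G : Type*) [Group G] : Subgroup G :=
  sSup {N : Subgroup G | N.Normal ∧ IsLocallyNilpotent N}

end LeftEngel

/-! The hypotheses on `a` enter only through a commutation rule on the set S of conjugates of `a`
and `a⁻¹` together with 1: for c in S, the conjugates of c by members of S commute. A set with this
rule still has it after its commutators are adjoined (`IsSandwichSet.adjoinCommutators`), so S lies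
in a commutator-closed one. There, as for sandwiches in Lie algebras, [t,y,y] = 1 and [t,y,b,y] = 1.

Local nilpotency then becomes combinatorics of words. Take finitely many generators in S and divide
by the union of the upper central series; no nontrivial element of the image of S commutes with all
generators. If a nontrivial element were left, left-normed commutators could be prolonged forever,
always by the greatest letter that does not kill everything. The factors of these greedy words
include x x, x w x or w x w with w Lyndon (`IsExtendableLanguage.exists_repetition`). On greedy
words a Lyndon word acts like a single element of S (`IsSandwichSet.exists_bracket`), so the
sandwich identities kill the repetition, a contradiction.

For strong left 3-Engel elements the rule is read off from the class bounds. A left 3-Engel element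
gives it only for pairs. When the order is odd, the commutator of `a` with its conjugate by bc (b, c
in S) is centralised by b and by c but inverted by bc; being its own inverse, it is trivial
(`IsWeakSandwichSet.pairing_eq_one`). -/

namespace LeftEngel

/-! ### Sandwich sets and commutator identities. -/

open scoped commutatorElement

variable {G : Type*} [Group G]

/-- A set of group elements, closed under inversion and conjugation, such that the conjugates of
any of its elements by elements of the set commute with each other. -/
structure IsSandwichSet (S : Set G) : Prop where
  one_mem : 1 ∈ S
  inv_mem : ∀ {a}, a ∈ S → a⁻¹ ∈ S
  conj_mem : ∀ {a}, a ∈ S → ∀ g, g * a * g⁻¹ ∈ S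
  commute : ∀ {c g h}, c ∈ S → g ∈ S → h ∈ S → Commute (g * c * g⁻¹) (h * c * h⁻¹)

/-- The subgroup generated by the conjugates of `a` by the elements of `T`. -/
def conjSpan (a : G) (T : Set G) : Subgroup G :=
  Subgroup.closure ((fun t => t * a * t⁻¹) '' T)

lemma conj_mem_conjSpan {a t : G} {T : Set G} (ht : t ∈ T) : t * a * t⁻¹ ∈ conjSpan a T :=
  Subgroup.subset_closure ⟨t, ht, rfl⟩

lemma self_mem_conjSpan {a : G} {T : Set G} (h1 : (1 : G) ∈ T) : a ∈ conjSpan a T := by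
  simpa using conj_mem_conjSpan (a := a) h1

lemma commute_of_mem_closure {A : Set G} {z x : G} (h : ∀ y ∈ A, Commute z y)
    (hx : x ∈ Subgroup.closure A) : Commute z x := by
  induction hx using Subgroup.closure_induction with
  | mem y hy => exact h y hy
  | one => exact Commute.one_right z
  | mul _ _ _ _ h1 h2 => exact h1.mul_right h2
  | inv _ _ h1 => exact h1.inv_right

lemma commute_of_mem_conjSpan {a x y : G} {T : Set G}
    (h : ∀ g ∈ T, ∀ k ∈ T, Commute (g * a * g⁻¹) (k * a * k⁻¹))
    (hx : x ∈ conjSpan a T) (hy : y ∈ conjSpan a T) : Commute x y := by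
  refine commute_of_mem_closure ?_ hy
  rintro _ ⟨k, hk, rfl⟩
  refine (commute_of_mem_closure ?_ hx).symm
  rintro _ ⟨g, hg, rfl⟩
  exact h k hk g hg

lemma mul_commutatorElement (x y z : G) : ⁅x * y, z⁆ = x * ⁅y, z⁆ * x⁻¹ * ⁅x, z⁆ := by
  simp only [commutatorElement_def]; group

lemma commutatorElement_mul (x y z : G) : ⁅x, y * z⁆ = ⁅x, y⁆ * (y * ⁅x, z⁆ * y⁻¹) := by
  simp only [commutatorElement_def]; group

lemma commutatorElement_eq_mul_conj_inv (x y : G) : ⁅x, y⁆ = x * (y * x * y⁻¹)⁻¹ := by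
  simp only [commutatorElement_def]; group

lemma commutatorElement_eq_conj_mul_inv (x y : G) : ⁅x, y⁆ = (x * y * x⁻¹) * y⁻¹ := by
  simp only [commutatorElement_def]

lemma conj_eq_self_of_commute {x y : G} (h : Commute x y) : x * y * x⁻¹ = y := by
  rw [h.eq]; group

lemma commute_conj_left_iff {x y g : G} :
    Commute (g * x * g⁻¹) y ↔ Commute x (g⁻¹ * y * g) := by
  rw [commute_iff_eq, commute_iff_eq]
  constructor
  · intro h
    calc x * (g⁻¹ * y * g) = g⁻¹ * (g * x * g⁻¹ * y) * g := by group
      _ = g⁻¹ * (y * (g * x * g⁻¹)) * g := by rw [h]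
      _ = _ := by group
  · intro h
    calc g * x * g⁻¹ * y = g * (x * (g⁻¹ * y * g)) * g⁻¹ := by group
      _ = g * (g⁻¹ * y * g * x) * g⁻¹ := by rw [h]
      _ = _ := by group

lemma commute_mul_conj {a g h : G} (H : Commute (g⁻¹ * a * g) (h * a * h⁻¹)) :
    Commute a ((g * h) * a * (g * h)⁻¹) := by
  have : Commute (g⁻¹ * a * g⁻¹⁻¹) (h * a * h⁻¹) := by simpa using H
  rw [commute_conj_left_iff] at this
  convert this using 1
  group

lemma commutatorElement_commutatorElement {a g b : G}
    (h : Commute (g * a * g⁻¹) ⁅a⁻¹, b⁆) :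
    ⁅⁅g, a⁆, b⁆ = ⁅a⁻¹, b⁆ * ⁅g * a * g⁻¹, b⁆ := by
  rw [commutatorElement_eq_conj_mul_inv g a, mul_commutatorElement, conj_eq_self_of_commute h]

/-! ### Commutators of two elements with commuting conjugates. -/

section Extension

variable {S T : Set G}

/-- Two elements of `T` each of which has commuting conjugates by elements of `T`. -/
structure CommutingPair (T : Set G) (a b : G) : Prop where
  left_mem : a ∈ T
  right_mem : b ∈ T
  left : ∀ g ∈ T, ∀ k ∈ T, Commute (g * a * g⁻¹) (k * a * k⁻¹)
  right : ∀ g ∈ T, ∀ k ∈ T, Commute (g * b * g⁻¹) (k * b * k⁻¹)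

lemma CommutingPair.symm {a b : G} (h : CommutingPair T a b) : CommutingPair T b a :=
  ⟨h.right_mem, h.left_mem, h.right, h.left⟩

variable (h1 : (1 : G) ∈ T) (hinv : ∀ {a}, a ∈ T → a⁻¹ ∈ T)
  (hconj : ∀ {a}, a ∈ T → ∀ g, g * a * g⁻¹ ∈ T)

include h1 in
lemma CommutingPair.commutator_mem_left {a g : G} (hg : g ∈ T) : ⁅a, g⁆ ∈ conjSpan a T := by
  rw [commutatorElement_eq_mul_conj_inv]
  exact mul_mem (self_mem_conjSpan h1) (inv_mem (conj_mem_conjSpan hg))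

include h1 in
lemma CommutingPair.commutator_mem_right {a g : G} (hg : g ∈ T) : ⁅g, a⁆ ∈ conjSpan a T := by
  rw [commutatorElement_eq_conj_mul_inv]
  exact mul_mem (conj_mem_conjSpan hg) (inv_mem (self_mem_conjSpan h1))

include h1 in
lemma CommutingPair.triple_eq {a b g : G} (h : CommutingPair T a b) (hg : g ∈ T) :
    ⁅⁅g, a⁆, b⁆ = ⁅a⁻¹, b⁆ * ⁅g * a * g⁻¹, b⁆ := by
  refine commutatorElement_commutatorElement
    (commute_of_mem_conjSpan h.left (conj_mem_conjSpan hg) ?_)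
  have : ⁅a⁻¹, b⁆ = a⁻¹ * (b * a * b⁻¹) := by simp only [commutatorElement_def]; group
  rw [this]
  exact mul_mem (inv_mem (self_mem_conjSpan h1)) (conj_mem_conjSpan h.right_mem)

include h1 hinv hconj in
-- By `triple_eq` this is a product of two commutators with `b`, hence of conjugates of `b` and
-- their inverses.
lemma CommutingPair.triple_mem {a b g : G} (h : CommutingPair T a b) (hg : g ∈ T) :
    ⁅⁅g, a⁆, b⁆ ∈ conjSpan b T := by
  rw [h.triple_eq h1 hg]
  exact mul_mem (CommutingPair.commutator_mem_right h1 (hinv h.left_mem))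
    (CommutingPair.commutator_mem_right h1 (hconj h.left_mem g))

include h1 hinv in
-- The factors in `triple_eq` are products of conjugates of `a` by 1, `b`, `g` and `b * g`. Only the
-- last is not covered directly by `h.left`; it reduces to conjugators `b⁻¹` and `g`.
lemma CommutingPair.commute_triple {a b g : G} (h : CommutingPair T a b) (hg : g ∈ T) :
    Commute a ⁅⁅g, a⁆, b⁆ := by
  rw [h.triple_eq h1 hg]
  have ha : Commute a (b * a * b⁻¹) := by simpa using h.left 1 h1 b h.right_mem
  refine Commute.mul_right ?_ ?_
  · have : ⁅a⁻¹, b⁆ = a⁻¹ * (b * a * b⁻¹) := by simp only [commutatorElement_def]; group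
    rw [this]
    exact (Commute.refl a).inv_right.mul_right ha
  · rw [commutatorElement_eq_mul_conj_inv]
    refine Commute.mul_right ?_ (Commute.inv_right ?_)
    · simpa using h.left 1 h1 g hg
    · have := commute_mul_conj (a := a) (g := b) (h := g)
        (by simpa using h.left b⁻¹ (hinv h.right_mem) g hg)
      convert this using 1
      group

include h1 hinv hconj in
-- Conjugation by `g` sends `a` to [g,a]a and `b` to [g,b]b. When the commutator of these is
-- expanded, `hab` removes one factor and all conjugations act trivially.
lemma CommutingPair.conj_commutator {a b g : G} (h : CommutingPair T a b) (hg : g ∈ T)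
    (hab : Commute ⁅g, a⁆ ⁅g, b⁆) :
    g * ⁅a, b⁆ * g⁻¹ = ⁅⁅g, b⁆, a⁆⁻¹ * ⁅a, b⁆ * ⁅⁅g, a⁆, b⁆ := by
  have e : g * ⁅a, b⁆ * g⁻¹ = ⁅⁅g, a⁆ * a, ⁅g, b⁆ * b⁆ := by
    simp only [commutatorElement_def]; group
  have c1 : Commute ⁅g, b⁆ ⁅a, b⁆ := commute_of_mem_conjSpan h.right
    (CommutingPair.commutator_mem_right h1 hg)
    (CommutingPair.commutator_mem_right h1 h.left_mem)
  have c2 : Commute ⁅g, a⁆ ⁅a, b⁆ := commute_of_mem_conjSpan h.left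
    (CommutingPair.commutator_mem_right h1 hg)
    (CommutingPair.commutator_mem_left h1 h.right_mem)
  have c3 : Commute ⁅g, a⁆ ⁅⁅g, b⁆, a⁆ := commute_of_mem_conjSpan h.left
    (CommutingPair.commutator_mem_right h1 hg) (h.symm.triple_mem h1 hinv hconj hg)
  have c4 : Commute ⁅g, b⁆ ⁅⁅g, a⁆, b⁆ := commute_of_mem_conjSpan h.right
    (CommutingPair.commutator_mem_right h1 hg) (h.triple_mem h1 hinv hconj hg)
  rw [e, mul_commutatorElement, commutatorElement_mul a, commutatorElement_mul ⁅g, a⁆,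
    conj_eq_self_of_commute c1, conj_eq_self_of_commute c4, hab.commutator_eq, one_mul,
    ← commutatorElement_inv ⁅g, b⁆ a, conj_eq_self_of_commute (c3.inv_right.mul_right c2)]

include h1 hinv hconj in
-- In `conj_commutator` every factor lies in the abelian span of `a` or of `b`, and [a,b] in both.
-- Only factors from different spans need an argument, which is `cross`: [[k,b],a] is a word in
-- [k,b] and `a`, and both commute with [[g,a],b].
lemma CommutingPair.commute_conj {a b g k : G} (h : CommutingPair T a b) (hg : g ∈ T) (hk : k ∈ T)
    (hg' : Commute ⁅g, a⁆ ⁅g, b⁆) (hk' : Commute ⁅k, a⁆ ⁅k, b⁆) :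
    Commute (g * ⁅a, b⁆ * g⁻¹) (k * ⁅a, b⁆ * k⁻¹) := by
  rw [h.conj_commutator h1 hinv hconj hg hg', h.conj_commutator h1 hinv hconj hk hk']
  have sa : ⁅a, b⁆ ∈ conjSpan a T := CommutingPair.commutator_mem_left h1 h.right_mem
  have sb : ⁅a, b⁆ ∈ conjSpan b T := CommutingPair.commutator_mem_right h1 h.left_mem
  have cross : ∀ {a b : G}, CommutingPair T a b → ∀ g ∈ T, ∀ k ∈ T,
      Commute ⁅⁅g, a⁆, b⁆ ⁅⁅k, b⁆, a⁆ := by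
    intro a b h g hg k hk
    have c1 : Commute ⁅⁅g, a⁆, b⁆ ⁅k, b⁆ := commute_of_mem_conjSpan h.right
      (h.triple_mem h1 hinv hconj hg) (CommutingPair.commutator_mem_right h1 hk)
    have c2 : Commute ⁅⁅g, a⁆, b⁆ a := (h.commute_triple h1 hinv hg).symm
    rw [commutatorElement_def ⁅k, b⁆ a]
    exact ((c1.mul_right c2).mul_right c1.inv_right).mul_right c2.inv_right
  have mA : ∀ {g}, g ∈ T → ⁅⁅g, b⁆, a⁆⁻¹ ∈ conjSpan a T := fun hg =>
    inv_mem (h.symm.triple_mem h1 hinv hconj hg)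
  have mB : ∀ {g}, g ∈ T → ⁅⁅g, a⁆, b⁆ ∈ conjSpan b T := fun hg =>
    h.triple_mem h1 hinv hconj hg
  have cA := fun {x y} => commute_of_mem_conjSpan (x := x) (y := y) h.left
  have cB := fun {x y} => commute_of_mem_conjSpan (x := x) (y := y) h.right
  refine Commute.mul_left (Commute.mul_left ?_ ?_) ?_
  · exact ((cA (mA hg) (mA hk)).mul_right (cA (mA hg) sa)).mul_right
      (cross h k hk g hg).symm.inv_left
  · exact ((cA sa (mA hk)).mul_right (Commute.refl _)).mul_right (cB sb (mB hk))
  · exact (((cross h g hg k hk).inv_right).mul_right (cB (mB hg) sb)).mul_right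
      (cB (mB hg) (mB hk))

end Extension

/-- The set `S` together with all commutators of its elements. -/
def adjoinCommutators (S : Set G) : Set G := S ∪ {s | ∃ a ∈ S, ∃ b ∈ S, ⁅a, b⁆ = s}

lemma IsSandwichSet.commute_commutators {S : Set G} (hS : IsSandwichSet S) {g a b : G} (hg : g ∈ S)
    (ha : a ∈ S) (hb : b ∈ S) : Commute ⁅g, a⁆ ⁅g, b⁆ :=
  commute_of_mem_conjSpan (fun _ hx _ hy => hS.commute hg hx hy)
    (CommutingPair.commutator_mem_left hS.one_mem ha)
    (CommutingPair.commutator_mem_left hS.one_mem hb)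

/-- Conjugating by [a,b] multiplies `c` by [[a,b],c], which is already in the span; so the new
conjugators do not enlarge the span of an old element. -/
lemma IsSandwichSet.conj_mem_conjSpan_of_adjoin {S : Set G} (hS : IsSandwichSet S) {c g : G}
    (hc : c ∈ S) (hg : g ∈ adjoinCommutators S) : g * c * g⁻¹ ∈ conjSpan c S := by
  rcases hg with hg | ⟨a, ha, b, hb, rfl⟩
  · exact conj_mem_conjSpan hg
  · have hp : CommutingPair S b c :=
      ⟨hb, hc, fun _ hx _ hy => hS.commute hb hx hy, fun _ hx _ hy => hS.commute hc hx hy⟩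
    have := hp.triple_mem hS.one_mem hS.inv_mem hS.conj_mem ha
    have e : ⁅a, b⁆ * c * ⁅a, b⁆⁻¹ = ⁅⁅a, b⁆, c⁆ * c := by
      rw [commutatorElement_def ⁅a, b⁆ c]; group
    rw [e]
    exact mul_mem this (self_mem_conjSpan hS.one_mem)

/-- The conjugated element and the conjugators may each be old or new. The case where all are new
applies `CommutingPair.commute_conj` a second time, now over the enlarged set, with its hypotheses
supplied by the mixed cases `hold` and `hnew`. -/
theorem IsSandwichSet.adjoinCommutators {S : Set G} (hS : IsSandwichSet S) :
    IsSandwichSet (adjoinCommutators S) := by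
  have h1 : (1 : G) ∈ LeftEngel.adjoinCommutators S := Or.inl hS.one_mem
  have hinv : ∀ {a}, a ∈ LeftEngel.adjoinCommutators S → a⁻¹ ∈ LeftEngel.adjoinCommutators S := by
    rintro _ (ha | ⟨a, ha, b, hb, rfl⟩)
    · exact Or.inl (hS.inv_mem ha)
    · exact Or.inr ⟨b, hb, a, ha, (commutatorElement_inv a b).symm⟩
  have hconj : ∀ {a}, a ∈ LeftEngel.adjoinCommutators S → ∀ g,
      g * a * g⁻¹ ∈ LeftEngel.adjoinCommutators S := by
    rintro _ (ha | ⟨a, ha, b, hb, rfl⟩) g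
    · exact Or.inl (hS.conj_mem ha g)
    · refine Or.inr ⟨_, hS.conj_mem ha g, _, hS.conj_mem hb g, ?_⟩
      simp only [commutatorElement_def]; group
  have hold : ∀ {c g h}, c ∈ S → g ∈ LeftEngel.adjoinCommutators S →
      h ∈ LeftEngel.adjoinCommutators S → Commute (g * c * g⁻¹) (h * c * h⁻¹) :=
    fun hc hg hh => commute_of_mem_conjSpan (fun _ hx _ hy => hS.commute hc hx hy)
      (hS.conj_mem_conjSpan_of_adjoin hc hg) (hS.conj_mem_conjSpan_of_adjoin hc hh)
  have hnew : ∀ {c g h}, c ∈ LeftEngel.adjoinCommutators S → g ∈ S → h ∈ S →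
      Commute (g * c * g⁻¹) (h * c * h⁻¹) := by
    rintro _ g h (hc | ⟨a, ha, b, hb, rfl⟩) hg hh
    · exact hS.commute hc hg hh
    · have hp : CommutingPair S a b :=
        ⟨ha, hb, fun _ hx _ hy => hS.commute ha hx hy, fun _ hx _ hy => hS.commute hb hx hy⟩
      exact hp.commute_conj hS.one_mem hS.inv_mem hS.conj_mem hg hh
        (hS.commute_commutators hg ha hb) (hS.commute_commutators hh ha hb)
  have hcomm : ∀ {g a b}, g ∈ LeftEngel.adjoinCommutators S → a ∈ S → b ∈ S →
      Commute ⁅g, a⁆ ⁅g, b⁆ := fun hg ha hb =>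
    commute_of_mem_conjSpan (fun _ hx _ hy => hnew hg hx hy)
      (CommutingPair.commutator_mem_left hS.one_mem ha)
      (CommutingPair.commutator_mem_left hS.one_mem hb)
  refine ⟨h1, hinv, hconj, ?_⟩
  rintro _ g h (hc | ⟨a, ha, b, hb, rfl⟩) hg hh
  · exact hold hc hg hh
  · have hp : CommutingPair (LeftEngel.adjoinCommutators S) a b :=
      ⟨Or.inl ha, Or.inl hb, fun _ hx _ hy => hold ha hx hy, fun _ hx _ hy => hold hb hx hy⟩
    exact hp.commute_conj h1 hinv hconj hg hh (hcomm hg ha hb) (hcomm hh ha hb)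

/-- Every sandwich set is contained in one that is closed under commutators. -/
theorem IsSandwichSet.exists_commutator_closed {S : Set G} (hS : IsSandwichSet S) :
    ∃ T : Set G, S ⊆ T ∧ IsSandwichSet T ∧ ∀ a ∈ T, ∀ b ∈ T, ⁅a, b⁆ ∈ T := by
  let F : ℕ → Set G := fun n => LeftEngel.adjoinCommutators^[n] S
  have hF : ∀ n, IsSandwichSet (F n) := by
    intro n
    induction n with
    | zero => exact hS
    | succ n ih =>
      simp only [F, Function.iterate_succ_apply']
      exact ih.adjoinCommutators
  have hsucc : ∀ n, F (n + 1) = LeftEngel.adjoinCommutators (F n) := fun n => by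
    simp only [F, Function.iterate_succ_apply']
  have hmono : Monotone F := monotone_nat_of_le_succ fun n => by
    rw [hsucc]; exact Set.subset_union_left
  refine ⟨⋃ n, F n, Set.subset_iUnion F 0, ⟨?_, ?_, ?_, ?_⟩, ?_⟩
  · exact Set.mem_iUnion.2 ⟨0, hS.one_mem⟩
  · intro a ha
    obtain ⟨n, hn⟩ := Set.mem_iUnion.1 ha
    exact Set.mem_iUnion.2 ⟨n, (hF n).inv_mem hn⟩
  · intro a ha g
    obtain ⟨n, hn⟩ := Set.mem_iUnion.1 ha
    exact Set.mem_iUnion.2 ⟨n, (hF n).conj_mem hn g⟩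
  · intro c g h hc hg hh
    obtain ⟨i, hi⟩ := Set.mem_iUnion.1 hc
    obtain ⟨j, hj⟩ := Set.mem_iUnion.1 hg
    obtain ⟨k, hk⟩ := Set.mem_iUnion.1 hh
    exact (hF (max i (max j k))).commute (hmono (by simp) hi) (hmono (by simp) hj)
      (hmono (by simp) hk)
  · intro a ha b hb
    obtain ⟨i, hi⟩ := Set.mem_iUnion.1 ha
    obtain ⟨j, hj⟩ := Set.mem_iUnion.1 hb
    refine Set.mem_iUnion.2 ⟨max i j + 1, ?_⟩
    rw [hsucc]
    exact Or.inr ⟨a, hmono (by simp) hi, b, hmono (by simp) hj, rfl⟩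

/-! ### Sandwich identities. -/

section Identities

variable {S : Set G} (hS : IsSandwichSet S)
include hS

lemma IsSandwichSet.commute_conj {a b : G} (ha : a ∈ S) (hb : b ∈ S) :
    Commute a (b * a * b⁻¹) := by
  simpa using hS.commute ha hS.one_mem hb

lemma IsSandwichSet.commute_commutator_left {a b : G} (ha : a ∈ S) (hb : b ∈ S) :
    Commute a ⁅a, b⁆ := by
  rw [commutatorElement_eq_mul_conj_inv]
  exact (Commute.refl a).mul_right (hS.commute_conj ha hb).inv_right

lemma IsSandwichSet.commute_commutator_right {a b : G} (ha : a ∈ S) (hb : b ∈ S) :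
    Commute b ⁅a, b⁆ := by
  rw [← commutatorElement_inv]
  exact (hS.commute_commutator_left hb ha).inv_right

lemma IsSandwichSet.commute_conj_commutator {a b g : G} (ha : a ∈ S) (hb : b ∈ S) (hg : g ∈ S) :
    Commute b (g * ⁅a, b⁆ * g⁻¹) := by
  have h : Commute (g⁻¹ * b * g) ⁅a, b⁆ := by
    refine commute_of_mem_conjSpan (fun _ hx _ hy => hS.commute hb hx hy) ?_
      (CommutingPair.commutator_mem_right hS.one_mem ha)
    simpa using conj_mem_conjSpan (a := b) (hS.inv_mem hg)
  have h' := commute_conj_left_iff (x := ⁅a, b⁆) (y := b) (g := g)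
  exact (h'.2 h.symm).symm

/-- [[t,y],b] is the product of [t,y] and the inverse of its conjugate by `b`, and `y` commutes with
both. -/
lemma IsSandwichSet.triple_commutator_eq_one {t y b : G} (ht : t ∈ S) (hy : y ∈ S) (hb : b ∈ S) :
    ⁅⁅⁅t, y⁆, b⁆, y⁆ = 1 := by
  refine Commute.commutator_eq (Commute.symm ?_)
  rw [commutatorElement_eq_mul_conj_inv]
  exact (hS.commute_commutator_right ht hy).mul_right
    (hS.commute_conj_commutator ht hy hb).inv_right

lemma IsSandwichSet.double_commutator_eq_one {t y : G} (ht : t ∈ S) (hy : y ∈ S) :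
    ⁅⁅t, y⁆, y⁆ = 1 :=
  Commute.commutator_eq (hS.commute_commutator_right ht hy).symm

/-- A Jacobi identity whose third term vanishes because `t` and `c` commute. It lets a bracket act
like the concatenation of its two parts. -/
lemma IsSandwichSet.commutator_commutator_of_commute {t b c : G} (ht : t ∈ S) (hb : b ∈ S)
    (hc : c ∈ S) (h : Commute t c) : ⁅t, ⁅b, c⁆⁆ = ⁅⁅t, b⁆, c⁆ := by
  have e1 : ⁅b, c⁆ = b * (c * b⁻¹ * c⁻¹) := by rw [commutatorElement_def]; group
  have e2 : ⁅t, c * b⁻¹ * c⁻¹⁆ = c * ⁅t, b⁻¹⁆ * c⁻¹ := by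
    have : c⁻¹ * t * c = t := by rw [mul_assoc, h.eq]; group
    calc ⁅t, c * b⁻¹ * c⁻¹⁆ = c * ⁅c⁻¹ * t * c, b⁻¹⁆ * c⁻¹ := by
          simp only [commutatorElement_def]; group
      _ = _ := by rw [this]
  have e3 : ⁅t, b⁻¹⁆ = ⁅t, b⁆⁻¹ := by
    have h := (hS.commute_commutator_right ht hb).inv_right.inv_left
    have := conj_eq_self_of_commute h
    rw [← this]
    simp only [commutatorElement_def]; group
  have e4 : Commute b (c * ⁅t, b⁆⁻¹ * c⁻¹) := by
    have := (hS.commute_conj_commutator ht hb hc).inv_right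
    convert this using 1
    group
  rw [e1, commutatorElement_mul, e2, e3, conj_eq_self_of_commute e4, commutatorElement_def ⁅t, b⁆]
  group

end Identities

end LeftEngel

namespace LeftEngel

/-! ### Lyndon words. -/

section Words

variable {α : Type*} [LinearOrder α]

/-- The words `a` and `b` differ at some position, and `a` has the smaller letter at the first
such position. -/
def Deviates (a b : List α) : Prop :=
  ∃ c e g t t', e < g ∧ a = c ++ e :: t ∧ b = c ++ g :: t'

/-- A Lyndon word: it is smaller than all its proper nonempty suffixes. -/
def IsLyndon (w : List α) : Prop :=
  w ≠ [] ∧ ∀ u v, u ≠ [] → v ≠ [] → w = u ++ v → Deviates w v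

lemma Deviates.append_right {a b : List α} (h : Deviates a b) (s t : List α) :
    Deviates (a ++ s) (b ++ t) := by
  obtain ⟨c, e, g, x, y, hl, rfl, rfl⟩ := h
  exact ⟨c, e, g, x ++ s, y ++ t, hl, by simp, by simp⟩

lemma Deviates.append_left {a b : List α} (h : Deviates a b) (s : List α) :
    Deviates (s ++ a) (s ++ b) := by
  obtain ⟨c, e, g, x, y, hl, rfl, rfl⟩ := h
  exact ⟨s ++ c, e, g, x, y, hl, by simp, by simp⟩

@[simp] lemma not_deviates_nil_left (b : List α) : ¬ Deviates [] b := by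
  rintro ⟨c, e, g, t, t', _, h, _⟩
  simp at h

@[simp] lemma not_deviates_nil_right (a : List α) : ¬ Deviates a [] := by
  rintro ⟨c, e, g, t, t', _, _, h⟩
  simp at h

lemma deviates_cons {x y : α} {a b : List α} :
    Deviates (x :: a) (y :: b) ↔ x < y ∨ (x = y ∧ Deviates a b) := by
  constructor
  · rintro ⟨c, e, g, t, t', hl, h1, h2⟩
    cases c with
    | nil =>
      simp only [List.nil_append, List.cons.injEq] at h1 h2
      exact Or.inl (by rw [h1.1, h2.1]; exact hl)
    | cons z c =>
      simp only [List.cons_append, List.cons.injEq] at h1 h2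
      exact Or.inr ⟨h1.1.trans h2.1.symm, c, e, g, t, t', hl, h1.2, h2.2⟩
  · rintro (h | ⟨rfl, h⟩)
    · exact ⟨[], x, y, a, b, h, rfl, rfl⟩
    · exact h.append_left [x]

lemma Deviates.trans {a b c : List α} (h1 : Deviates a b) (h2 : Deviates b c) : Deviates a c := by
  induction a generalizing b c with
  | nil => simp at h1
  | cons x a ih =>
    cases b with
    | nil => simp at h1
    | cons y b =>
      cases c with
      | nil => simp at h2
      | cons z c =>
        rw [deviates_cons] at *
        rcases h1 with h1 | ⟨rfl, h1⟩
        · rcases h2 with h2 | ⟨rfl, h2⟩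
          · exact Or.inl (h1.trans h2)
          · exact Or.inl h1
        · rcases h2 with h2 | ⟨rfl, h2⟩
          · exact Or.inl h2
          · exact Or.inr ⟨rfl, ih h1 h2⟩

/-- Two words deviate in one of the two directions, or one is a prefix of the other. -/
lemma deviates_trichotomy (a b : List α) :
    Deviates a b ∨ Deviates b a ∨ a <+: b ∨ b <+: a := by
  induction a generalizing b with
  | nil => simp
  | cons x a ih =>
    cases b with
    | nil => simp
    | cons y b =>
      simp only [deviates_cons, List.cons_prefix_cons]
      rcases lt_trichotomy x y with h | rfl | h
      · simp [h]
      · simpa using ih b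
      · simp [h]

lemma deviates_append_left_iff {s a b : List α} : Deviates (s ++ a) (s ++ b) ↔ Deviates a b := by
  induction s with
  | nil => simp
  | cons x s ih => simp [deviates_cons, ih]

lemma Deviates.lt {a b : List α} (h : Deviates a b) : a < b := by
  obtain ⟨c, e, g, x, y, hl, rfl, rfl⟩ := h
  exact List.append_left_lt (List.Lex.rel hl)

/-- Every Lyndon word of length at least two is a product of two shorter Lyndon words. -/
lemma IsLyndon.exists_factorization {w : List α} (h : IsLyndon w) (h2 : 2 ≤ w.length) :
    ∃ u v, IsLyndon u ∧ IsLyndon v ∧ w = u ++ v ∧ Deviates w v := by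
  classical
  let F : Finset ℕ := (Finset.Ico 1 w.length)
  have hF : F.Nonempty := ⟨1, by simp [F]; omega⟩
  -- The cut is made before the lexicographically least proper nonempty suffix; in the order on
  -- lists a proper prefix counts as smaller.
  obtain ⟨k, hk, hmin⟩ := F.exists_min_image (fun k => w.drop k) hF
  simp only [F, Finset.mem_Ico] at hk hmin
  have hw : w = w.take k ++ w.drop k := (List.take_append_drop k w).symm
  have hv0 : w.drop k ≠ [] := by simp; omega
  have hu0 : w.take k ≠ [] := by
    intro h0
    have := congrArg List.length h0
    rw [List.length_take, List.length_nil] at this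
    omega
  have hmin' : ∀ p q : List α, p ≠ [] → q ≠ [] → w = p ++ q → w.drop k ≤ q := by
    intro p q hp hq e
    have := hmin p.length ⟨List.length_pos_iff.2 hp, by
      rw [e, List.length_append]; have := List.length_pos_iff.2 hq; omega⟩
    rwa [e, List.drop_left, ← e] at this
  have not_lt : ∀ {a b : List α}, a ≤ b → ¬ Deviates b a := fun hab hd =>
    absurd hd.lt (not_lt.2 hab)
  refine ⟨w.take k, w.drop k, ⟨hu0, ?_⟩, ⟨hv0, ?_⟩, hw, h.2 _ _ hu0 hv0 hw⟩
  · intro p q hp hq e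
    have e' : w = p ++ (q ++ w.drop k) := by
      rw [← List.append_assoc, ← e]; exact hw
    have hd := h.2 p (q ++ w.drop k) hp (by simp [hq]) e'
    rcases deviates_trichotomy (w.take k) q with h1 | h1 | h1 | h1
    · exact h1
    · exfalso
      have := h1.append_right (w.drop k) (w.drop k)
      rw [← hw] at this
      exact absurd (this.trans hd).lt (lt_irrefl _)
    · exfalso
      have := h1.length_le
      rw [e, List.length_append] at this
      have := List.length_pos_iff.2 hp
      omega
    · exfalso
      obtain ⟨r, hr⟩ := h1
      have e'' : w = q ++ (r ++ w.drop k) := by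
        rw [← List.append_assoc, hr]; exact hw
      -- Cancelling the common prefix `q` leaves a suffix of `w` smaller than the least one.
      rw [e'', deviates_append_left_iff, ← e''] at hd
      exact not_lt (hmin' q (r ++ w.drop k) hq (by simp [hv0]) e'') hd
  · intro p q hp hq e
    have hle := hmin' (w.take k ++ p) q (by simp [hp]) hq (by rw [List.append_assoc, ← e]; exact hw)
    rcases deviates_trichotomy (w.drop k) q with h1 | h1 | h1 | h1
    · exact h1
    · exact absurd h1 (not_lt hle)
    · exfalso
      have := h1.length_le
      rw [e, List.length_append] at this
      have := List.length_pos_iff.2 hp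
      omega
    · exfalso
      obtain ⟨r, hr⟩ := h1
      have : r = [] := by
        rw [← hr] at hle
        by_contra hr0
        have h3 : q < q ++ r := by
          conv_lhs => rw [← List.append_nil q]
          obtain ⟨x, r', rfl⟩ := List.exists_cons_of_ne_nil hr0
          exact List.append_left_lt List.Lex.nil
        exact absurd hle (not_le.2 h3)
      rw [this, List.append_nil] at hr
      have := congrArg List.length e
      rw [← hr, List.length_append] at this
      have := List.length_pos_iff.2 hp
      omega

end Words

end LeftEngel

namespace LeftEngel

/-! ### Extendable languages and unavoidable repetitions. -/

section Languages

variable {α : Type*}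

/-- A nonempty set of words, closed under factors, in which every word can be extended to the
right. -/
structure IsExtendableLanguage (L : Set (List α)) : Prop where
  nil_mem : [] ∈ L
  factor_mem : ∀ {u v w}, u ++ v ++ w ∈ L → v ∈ L
  extend : ∀ {w}, w ∈ L → ∃ x, w ++ [x] ∈ L

lemma IsExtendableLanguage.sInter [Finite α] {c : Set (Set (List α))} (hne : c.Nonempty)
    (hc : IsChain (· ⊆ ·) c) (h : ∀ L ∈ c, IsExtendableLanguage L) :
    IsExtendableLanguage (⋂₀ c) := by
  refine ⟨fun L hL => (h L hL).nil_mem, fun hw L hL => (h L hL).factor_mem (hw L hL), ?_⟩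
  intro w hw
  by_contra! hno
  have : ∀ x, ∃ L : c, w ++ [x] ∉ L.1 := fun x => by
    obtain ⟨L, hL, hx⟩ := by simpa using hno x
    exact ⟨⟨L, hL⟩, hx⟩
  choose g hg using this
  have : Nonempty c := hne.to_subtype
  have hd : Directed (· ⊇ ·) (fun L : c => L.1) := by
    intro A B
    rcases hc.total A.2 B.2 with h1 | h1
    · exact ⟨A, subset_rfl, h1⟩
    · exact ⟨B, h1, subset_rfl⟩
  -- Finiteness of the alphabet: one member of the chain lies inside all the languages `g x`, so `w`
  -- would have no extension in it.
  obtain ⟨z, hz⟩ := hd.finite_le g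
  obtain ⟨x, hx⟩ := (h z.1 z.2).extend (hw z.1 z.2)
  exact hg x (hz x hx)

/-- By Zorn's lemma. Minimality plays the role of uniform recurrence for the infinite words used
below. -/
lemma IsExtendableLanguage.exists_minimal [Finite α] {L₀ : Set (List α)}
    (h : IsExtendableLanguage L₀) :
    ∃ L ⊆ L₀, IsExtendableLanguage L ∧ ∀ L' ⊆ L, IsExtendableLanguage L' → L' = L := by
  obtain ⟨L, hL⟩ := zorn_superset {L | IsExtendableLanguage L ∧ L ⊆ L₀} (by
    intro c hcS hc
    rcases c.eq_empty_or_nonempty with rfl | hne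
    · exact ⟨L₀, ⟨h, subset_rfl⟩, by simp⟩
    · obtain ⟨A, hA⟩ := hne
      exact ⟨⋂₀ c, ⟨.sInter ⟨A, hA⟩ hc fun L hL => (hcS hL).1,
        (Set.sInter_subset_of_mem hA).trans (hcS hA).2⟩, fun s hs => Set.sInter_subset_of_mem hs⟩)
  refine ⟨L, hL.prop.2, hL.prop.1, fun L' hL' h' => ?_⟩
  exact hL'.antisymm (hL.le_of_le ⟨h', hL'.trans hL.prop.2⟩ hL')

/-- The factor of length `n` of the infinite word `m` that starts at position `k`. -/
def seg (m : ℕ → α) (k n : ℕ) : List α := (List.range n).map fun i => m (k + i)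

@[simp] lemma length_seg (m : ℕ → α) (k n : ℕ) : (seg m k n).length = n := by simp [seg]

@[simp] lemma seg_zero (m : ℕ → α) (k : ℕ) : seg m k 0 = [] := rfl

lemma seg_succ (m : ℕ → α) (k n : ℕ) : seg m k (n + 1) = seg m k n ++ [m (k + n)] := by
  simp [seg, List.range_succ]

lemma seg_one (m : ℕ → α) (k : ℕ) : seg m k 1 = [m k] := by simp [seg]

lemma seg_add (m : ℕ → α) (k a b : ℕ) : seg m k (a + b) = seg m k a ++ seg m (k + a) b := by
  induction b with
  | zero => simp
  | succ b ih => rw [← add_assoc, seg_succ, ih, seg_succ, List.append_assoc, add_assoc]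

lemma seg_eq_append {m : ℕ → α} {k n : ℕ} {u v : List α} (h : seg m k n = u ++ v) :
    u = seg m k u.length ∧ v = seg m (k + u.length) v.length := by
  have hn : n = u.length + v.length := by
    have := congrArg List.length h
    simpa using this
  rw [hn, seg_add] at h
  obtain ⟨h1, h2⟩ := List.append_inj h (by simp)
  exact ⟨h1.symm, h2.symm⟩

lemma seg_prefix {m : ℕ → α} {k a b : ℕ} (h : a ≤ b) : ∃ t, seg m k b = seg m k a ++ t := by
  obtain ⟨c, rfl⟩ := Nat.exists_eq_add_of_le h
  exact ⟨_, seg_add m k a c⟩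

/-- In a minimal extendable language every prefix of an infinite word recurs. -/
lemma exists_recurrence {L : Set (List α)}
    (hmin : ∀ L' ⊆ L, IsExtendableLanguage L' → L' = L) {m : ℕ → α}
    (hm : ∀ k n, seg m k n ∈ L) (n : ℕ) : ∃ d, 1 ≤ d ∧ seg m d n = seg m 0 n := by
  -- The words occurring in `m` at a positive position form an extendable sublanguage, which by
  -- minimality is all of `L`.
  have key : {w | ∃ k, 1 ≤ k ∧ w = seg m k w.length} = L := by
    refine hmin _ ?_ ⟨⟨1, le_rfl, rfl⟩, ?_, ?_⟩
    · rintro w ⟨k, _, hw⟩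
      rw [hw]
      exact hm _ _
    · rintro u v w ⟨k, hk, h⟩
      obtain ⟨h1, _⟩ := seg_eq_append h.symm
      obtain ⟨_, h2⟩ := seg_eq_append h1.symm
      exact ⟨k + u.length, by omega, h2⟩
    · rintro w ⟨k, hk, h⟩
      refine ⟨m (k + w.length), k, hk, ?_⟩
      rw [List.length_append, List.length_singleton, seg_succ, ← h]
  have := hm 0 n
  rw [← key] at this
  obtain ⟨d, hd, h⟩ := this
  rw [length_seg] at h
  exact ⟨d, hd, h.symm⟩

/-- For each letter, the prefixes it may precede are closed under shortening; a bound common to the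
finitely many letters decides whether it may precede all of them. -/
lemma exists_stable_length [Finite α] {L : Set (List α)} (hL : IsExtendableLanguage L)
    (m : ℕ → α) : ∃ N, ∀ y, [y] ++ seg m 0 N ∈ L → ∀ n, [y] ++ seg m 0 n ∈ L := by
  classical
  have : ∀ y, ∃ N, [y] ++ seg m 0 N ∈ L → ∀ n, [y] ++ seg m 0 n ∈ L := by
    intro y
    by_cases h : ∀ n, [y] ++ seg m 0 n ∈ L
    · exact ⟨0, fun _ => h⟩
    · push Not at h
      obtain ⟨N, hN⟩ := h
      exact ⟨N, fun h => absurd h hN⟩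
  choose N hN using this
  obtain ⟨B, hB⟩ := (Set.finite_range N).bddAbove
  refine ⟨B, fun y hy => hN y ?_⟩
  have hle : N y ≤ B := hB ⟨y, rfl⟩
  obtain ⟨t, ht⟩ := seg_prefix (m := m) (k := 0) hle
  rw [ht, ← List.append_assoc] at hy
  exact hL.factor_mem (u := []) (by simpa using hy)

variable [LinearOrder α]

/-- The lexicographically least infinite word all of whose factors lie in a given language. -/
lemma IsExtendableLanguage.exists_least [Finite α] {L : Set (List α)}
    (h : IsExtendableLanguage L) :
    ∃ m : ℕ → α, (∀ k n, seg m k n ∈ L) ∧ ∀ w ∈ L, ∀ n, ¬ Deviates w (seg m 0 n) := by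
  classical
  -- The infinite word is built greedily from least admissible letters; a smaller deviating word
  -- would contradict the choice at its first differing letter.
  have hstep : ∀ w : L, ∃ x, w.1 ++ [x] ∈ L ∧ ∀ y, w.1 ++ [y] ∈ L → x ≤ y := by
    intro w
    obtain ⟨x, hx⟩ := h.extend w.2
    obtain ⟨z, hz, hmin⟩ := Set.exists_min_image {x | w.1 ++ [x] ∈ L} id (Set.toFinite _) ⟨x, hx⟩
    exact ⟨z, hz, hmin⟩
  choose f hf hmin using hstep
  let W : ℕ → L := fun n => Nat.rec ⟨[], h.nil_mem⟩ (fun _ w => ⟨w.1 ++ [f w], hf w⟩) n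
  have hW : ∀ n, (W (n + 1)).1 = (W n).1 ++ [f (W n)] := fun n => rfl
  have hseg : ∀ n, seg (fun n => f (W n)) 0 n = (W n).1 := by
    intro n
    induction n with
    | zero => rfl
    | succ n ih => rw [seg_succ, ih, hW, zero_add]
  refine ⟨fun n => f (W n), fun k n => ?_, ?_⟩
  · have h1 : seg (fun n => f (W n)) 0 (k + n) ∈ L := by rw [hseg]; exact (W _).2
    rw [seg_add, zero_add] at h1
    exact h.factor_mem (w := []) (by simpa using h1)
  · rintro w hw n ⟨c, e, g, t, t', hl, rfl, h2⟩
    obtain ⟨h3, h4⟩ := seg_eq_append h2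
    have hg : g = f (W c.length) := by
      rw [List.length_cons, add_comm t'.length, seg_add, seg_one, zero_add] at h4
      exact (List.cons.inj h4).1
    have hc : c ++ [e] ∈ L := h.factor_mem (u := []) (w := t) (by simpa using hw)
    rw [h3, hseg] at hc
    have := hmin _ _ hc
    rw [← hg] at this
    exact absurd hl (not_lt.2 this)

/-- If no proper suffix of a prefix of a least infinite word is greater than that prefix, the
prefix has a border which is a Lyndon word. -/
lemma exists_lyndon_border {L : Set (List α)} {m : ℕ → α} (hm : ∀ k n, seg m k n ∈ L)
    (hleast : ∀ w ∈ L, ∀ n, ¬ Deviates w (seg m 0 n)) {n : ℕ} (hn : n ≠ 0)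
    (hT : ¬ IsLyndon (seg m 0 n)) :
    ∃ l k, l ≠ 0 ∧ k ≠ 0 ∧ k + l = n ∧ seg m k l = seg m 0 l ∧ IsLyndon (seg m 0 l) := by
  classical
  have border : ∀ n, n ≠ 0 → ¬ IsLyndon (seg m 0 n) →
      ∃ l k, l ≠ 0 ∧ k ≠ 0 ∧ k + l = n ∧ seg m k l = seg m 0 l := by
    intro n hn hT
    unfold IsLyndon at hT
    push Not at hT
    obtain ⟨u, v, hu, hv, e, hd⟩ := hT (by
      intro h0
      have := congrArg List.length h0
      simp at this
      exact hn this)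
    obtain ⟨h1, h2⟩ := seg_eq_append e
    rw [zero_add] at h2
    have hlen : u.length + v.length = n := by
      have := congrArg List.length e
      simpa using this.symm
    have hu0 := List.length_pos_iff.2 hu
    have hv0 := List.length_pos_iff.2 hv
    refine ⟨v.length, u.length, by omega, by omega, hlen, ?_⟩
    have hvL : v ∈ L := by rw [h2]; exact hm _ _
    rcases deviates_trichotomy (seg m 0 n) v with h | h | h | h
    · exact absurd h hd
    · exact absurd h (hleast v hvL n)
    · have := h.length_le
      rw [length_seg] at this
      omega
    · obtain ⟨r, hr⟩ := h
      rw [← h2]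
      exact (seg_eq_append hr.symm).1
  -- The shortest border is taken: a border of it would be a shorter border of the whole prefix, so
  -- it must be Lyndon.
  have hex : ∃ l, l ≠ 0 ∧ ∃ k, k ≠ 0 ∧ k + l = n ∧ seg m k l = seg m 0 l := by
    obtain ⟨l, k, h1, h2, h3, h4⟩ := border n hn hT
    exact ⟨l, h1, k, h2, h3, h4⟩
  obtain ⟨hl, k, hk, hkl, he⟩ := Nat.find_spec hex
  set l := Nat.find hex with hldef
  refine ⟨l, k, hl, hk, hkl, he, ?_⟩
  by_contra hLy
  obtain ⟨l', k', h1, h2, h3, h4⟩ := border l hl hLy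
  have hlt : l' < l := by omega
  refine Nat.find_min hex hlt ⟨h1, k + k', by omega, by omega, ?_⟩
  rw [← h3, seg_add, seg_add, zero_add] at he
  rw [(List.append_inj he (by simp)).2, h4]

/-- Every extendable language over a finite alphabet contains the square of a letter, or a word
`x t x` or `t x t` with `x` a letter and `t` a Lyndon word. -/
theorem IsExtendableLanguage.exists_repetition [Finite α] {L₀ : Set (List α)}
    (h₀ : IsExtendableLanguage L₀) :
    (∃ x, [x] ++ [x] ∈ L₀) ∨ (∃ x t, IsLyndon t ∧ [x] ++ t ++ [x] ∈ L₀) ∨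
      ∃ x t, IsLyndon t ∧ t ++ [x] ++ t ∈ L₀ := by
  classical
  obtain ⟨L, hL₀, hL, hmin⟩ := h₀.exists_minimal
  obtain ⟨m, hm, hleast⟩ := hL.exists_least
  obtain ⟨N, hN⟩ := exists_stable_length hL m
  -- `d = n + 1` is the first return time of the prefix of length `N`. The letter `m n` just before
  -- the return may then precede every prefix, by choice of `N`.
  have hex := exists_recurrence hmin hm N
  obtain ⟨hd1, hd⟩ := Nat.find_spec hex
  have hdmin := fun k => Nat.find_min hex (m := k)
  generalize Nat.find hex = d at hd1 hd hdmin
  obtain ⟨n, rfl⟩ : ∃ n, d = n + 1 := ⟨d - 1, by omega⟩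
  have hy : ∀ k, [m n] ++ seg m 0 k ∈ L := by
    refine hN _ ?_
    rw [← hd, ← seg_one m n, ← seg_add]
    exact hm _ _
  have hpre : seg m 0 (n + 1) = seg m 0 n ++ [m n] := by rw [seg_succ, zero_add]
  by_cases hn : n = 0
  · refine Or.inl ⟨m 0, hL₀ ?_⟩
    have := hy 1
    rwa [seg_one, hn] at this
  by_cases hT : IsLyndon (seg m 0 n)
  · refine Or.inr (Or.inl ⟨m n, _, hT, hL₀ ?_⟩)
    rw [List.append_assoc, ← hpre]
    exact hy _
  · obtain ⟨l, k, hl, hk, hkl, he, hLy⟩ := exists_lyndon_border hm hleast hn hT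
    refine Or.inr (Or.inr ⟨m n, _, hLy, hL₀ ?_⟩)
    -- A border longer than `N` would bring the prefix of length `N` back at position `k`, before
    -- the first return time.
    have hlN : l ≤ N := by
      by_contra hlt
      push Not at hlt
      obtain ⟨r, hr⟩ := Nat.exists_eq_add_of_le hlt.le
      rw [hr, seg_add, seg_add] at he
      exact hdmin k (by omega) ⟨by omega, (List.append_inj he (by simp)).1⟩
    have hret : seg m (n + 1) l = seg m 0 l := by
      obtain ⟨r, hr⟩ := Nat.exists_eq_add_of_le hlN
      rw [hr, seg_add, seg_add] at hd
      exact (List.append_inj hd (by simp)).1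
    -- The border ends at position `n`, where `m n` stands; the return at `n + 1` then supplies the
    -- second copy.
    have : seg m k (l + 1 + l) = seg m 0 l ++ [m n] ++ seg m 0 l := by
      rw [seg_add, seg_succ, he, ← add_assoc, hkl, hret]
    rw [← this]
    exact hm _ _

end Languages

end LeftEngel

namespace LeftEngel

open scoped commutatorElement

/-! ### Words acting by iterated commutators. -/

section Action

variable {G α : Type*} [Group G] (x : α → G)

/-- The left-normed commutator `[t, x i₁, …, x iₙ]` attached to the word `i₁ … iₙ`. -/
def wordComm (t : G) (w : List α) : G := w.foldl (fun s i => ⁅s, x i⁆) t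

@[simp] lemma wordComm_nil (t : G) : wordComm x t [] = t := rfl

lemma wordComm_append (t : G) (u v : List α) :
    wordComm x t (u ++ v) = wordComm x (wordComm x t u) v := List.foldl_append

@[simp] lemma wordComm_singleton (t : G) (i : α) : wordComm x t [i] = ⁅t, x i⁆ := rfl

lemma wordComm_one (w : List α) : wordComm x 1 w = 1 := by
  induction w with
  | nil => rfl
  | cons i w ih => simpa [wordComm] using ih

lemma wordComm_mem {S : Set G} (hS : ∀ a ∈ S, ∀ b ∈ S, ⁅a, b⁆ ∈ S) (hx : ∀ i, x i ∈ S) {t : G}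
    (ht : t ∈ S) (w : List α) : wordComm x t w ∈ S := by
  induction w generalizing t with
  | nil => exact ht
  | cons i w ih => exact ih (hS _ ht _ (hx i))

variable [LinearOrder α]

/-- The words that deviate upwards from `w` annihilate `t`. -/
def IsTop (t : G) (w : List α) : Prop :=
  ∀ u e v, w = u ++ e :: v → ∀ g, e < g → wordComm x t (u ++ [g]) = 1

variable {x}

lemma IsTop.of_append {t : G} {u v : List α} (h : IsTop x t (u ++ v)) :
    IsTop x t u ∧ IsTop x (wordComm x t u) v := by
  constructor
  · rintro p e q rfl g hg
    exact h p e (q ++ v) (by simp) g hg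
  · rintro p e q rfl g hg
    rw [← wordComm_append, ← List.append_assoc]
    exact h (u ++ p) e q (by simp) g hg

/-- A Lyndon word can be bracketed to an element that acts like the word itself, up to words that
deviate upwards. -/
theorem IsSandwichSet.exists_bracket {S : Set G} (hS : IsSandwichSet S)
    (hcl : ∀ a ∈ S, ∀ b ∈ S, ⁅a, b⁆ ∈ S) (hx : ∀ i, x i ∈ S) {w : List α} (hw : IsLyndon w) :
    ∃ b ∈ S, ∀ t ∈ S, (IsTop x t w → ⁅t, b⁆ = wordComm x t w) ∧
      ∀ w', IsTop x t w' → Deviates w' w → ⁅t, b⁆ = 1 := by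
  induction hn : w.length using Nat.strong_induction_on generalizing w with
  | _ n ih =>
  have hpos := List.length_pos_iff.2 hw.1
  by_cases h1 : w.length = 1
  · obtain ⟨i, rfl⟩ := List.length_eq_one_iff.1 h1
    refine ⟨x i, hx i, fun t ht => ⟨fun _ => rfl, ?_⟩⟩
    rintro _ htop ⟨c, e, g, s, s', hl, rfl, h2⟩
    obtain ⟨rfl, h3⟩ : c = [] ∧ g = i := by
      cases c with
      | nil => simpa using (List.cons.inj h2).1.symm
      | cons y c => simp at h2
    subst h3
    exact htop [] e s rfl g hl
  · obtain ⟨u, v, hu, hv, rfl, hd⟩ := hw.exists_factorization (by omega)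
    have hu0 := List.length_pos_iff.2 hu.1
    have hv0 := List.length_pos_iff.2 hv.1
    rw [List.length_append] at hn
    obtain ⟨b, hb, Hb⟩ := ih u.length (by omega) hu rfl
    obtain ⟨c, hc, Hc⟩ := ih v.length (by omega) hv rfl
    -- In both clauses the top word deviates below `v`, so the second clause for `c` makes `t`
    -- commute with `c`, and the bracket acts as first `b`, then `c`.
    refine ⟨⁅b, c⁆, hcl b hb c hc, fun t ht => ⟨fun htop => ?_, fun w' htop hdev => ?_⟩⟩
    · have htc : Commute t c :=
        commutatorElement_eq_one_iff_commute.1 ((Hc t ht).2 _ htop hd)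
      rw [hS.commutator_commutator_of_commute ht hb hc htc, (Hb t ht).1 htop.of_append.1,
        (Hc _ (wordComm_mem x hcl hx ht u)).1 htop.of_append.2, wordComm_append]
    · have htc : Commute t c :=
        commutatorElement_eq_one_iff_commute.1 ((Hc t ht).2 _ htop (hdev.trans hd))
      rcases deviates_trichotomy w' u with h | h | h | h
      · have htb : Commute t b := commutatorElement_eq_one_iff_commute.1 ((Hb t ht).2 _ htop h)
        rw [hS.commutator_commutator_of_commute ht hb hc htc, htb.commutator_eq,
          commutatorElement_one_left]
      · have h3 := h.append_right v []
        rw [List.append_nil] at h3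
        exact absurd (h3.trans hdev).lt (lt_irrefl _)
      · obtain ⟨r, rfl⟩ := h
        have := hdev
        rw [List.append_assoc] at this
        nth_rewrite 1 [← List.append_nil w'] at this
        rw [deviates_append_left_iff] at this
        simp at this
      · obtain ⟨r, rfl⟩ := h
        rw [hS.commutator_commutator_of_commute ht hb hc htc, (Hb t ht).1 htop.of_append.1]
        exact (Hc _ (wordComm_mem x hcl hx ht u)).2 r htop.of_append.2
          (deviates_append_left_iff.1 hdev)

/-- In a commutator-closed sandwich set, if no nontrivial element commutes with finitely many
given elements, then all elements are trivial. -/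
theorem IsSandwichSet.eq_one_of_center [Finite α] {S : Set G} (hS : IsSandwichSet S)
    (hcl : ∀ a ∈ S, ∀ b ∈ S, ⁅a, b⁆ ∈ S) (hx : ∀ i, x i ∈ S)
    (hZ : ∀ s ∈ S, (∀ i, Commute s (x i)) → s = 1) : ∀ s ∈ S, s = 1 := by
  classical
  by_contra! hne
  obtain ⟨s, hs, hs1⟩ := hne
  let alive : List α → Prop := fun w => ∃ t ∈ S, wordComm x t w ≠ 1
  -- The greedy words: not killing all of `S`, while every upward deviation kills all of `S`.
  let A : Set (List α) := {w | alive w ∧ ∀ t ∈ S, IsTop x t w}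
  have hnil : [] ∈ A := ⟨⟨s, hs, hs1⟩, fun t _ u e v h => by simp at h⟩
  have hprefix : ∀ {u v}, u ++ v ∈ A → u ∈ A := by
    rintro u v ⟨⟨t, ht, h1⟩, h2⟩
    refine ⟨⟨t, ht, fun h => h1 ?_⟩, fun t ht => (h2 t ht).of_append.1⟩
    rw [wordComm_append, h, wordComm_one]
  have hext : ∀ {w}, w ∈ A → ∃ i, w ++ [i] ∈ A := by
    rintro w ⟨⟨t, ht, h1⟩, h2⟩
    have : ∃ i, alive (w ++ [i]) := by
      by_contra! hno
      refine h1 (hZ _ (wordComm_mem x hcl hx ht w) fun i => ?_)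
      rw [← commutatorElement_eq_one_iff_commute]
      by_contra h3
      exact hno i ⟨t, ht, by rwa [wordComm_append, wordComm_singleton]⟩
    -- The greatest letter keeping the word alive: all larger letters annihilate, which is the top
    -- condition at the new position.
    obtain ⟨i, hi, hmax⟩ := Set.exists_max_image {i | alive (w ++ [i])} id (Set.toFinite _) this
    refine ⟨i, hi, fun t ht u e v h g hg => ?_⟩
    rcases List.eq_nil_or_concat v with rfl | ⟨v', j, rfl⟩
    · obtain ⟨rfl, h4⟩ := List.append_inj' h rfl
      obtain rfl : i = e := by simpa using h4
      by_contra h5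
      exact absurd hg (not_lt.2 (hmax g ⟨t, ht, h5⟩))
    · rw [List.concat_eq_append, ← List.cons_append, ← List.append_assoc] at h
      exact h2 t ht u e v' (List.append_inj' h rfl).1 g hg
  have hL : IsExtendableLanguage {f | ∃ p, p ++ f ∈ A} := by
    refine ⟨⟨[], hnil⟩, ?_, ?_⟩
    · rintro u v w ⟨p, hp⟩
      refine ⟨p ++ u, hprefix (v := w) ?_⟩
      simpa using hp
    · rintro w ⟨p, hp⟩
      obtain ⟨i, hi⟩ := hext hp
      exact ⟨i, p, by simpa using hi⟩
  -- The prefix `p` is absorbed into the element acted on, replacing t by [t,p].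
  have hkill : ∀ f, (∃ p, p ++ f ∈ A) → ∃ t ∈ S, wordComm x t f ≠ 1 ∧ IsTop x t f := by
    rintro f ⟨p, ⟨t, ht, h1⟩, h2⟩
    exact ⟨_, wordComm_mem x hcl hx ht p, by rwa [← wordComm_append], (h2 t ht).of_append.2⟩
  rcases hL.exists_repetition with ⟨i, h⟩ | ⟨i, w, hw, h⟩ | ⟨i, w, hw, h⟩
  · obtain ⟨t, ht, h1, -⟩ := hkill _ h
    exact h1 (hS.double_commutator_eq_one ht (hx i))
  · obtain ⟨t, ht, h1, h2⟩ := hkill _ h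
    obtain ⟨b, hb, Hb⟩ := hS.exists_bracket hcl hx hw
    apply h1
    have h3 := h2.of_append.1.of_append.2
    rw [wordComm_append, wordComm_append, wordComm_singleton, wordComm_singleton]
    rw [wordComm_singleton] at h3
    rw [← (Hb _ (hcl _ ht _ (hx i))).1 h3]
    exact hS.triple_commutator_eq_one ht (hx i) hb
  · obtain ⟨t, ht, h1, h2⟩ := hkill _ h
    obtain ⟨b, hb, Hb⟩ := hS.exists_bracket hcl hx hw
    apply h1
    have h3 := h2.of_append.1.of_append.1
    have h4 := h2.of_append.2
    rw [wordComm_append, wordComm_append, wordComm_singleton] at *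
    rw [← (Hb _ ht).1 h3] at *
    rw [← (Hb _ (hcl _ (hcl _ ht _ hb) _ (hx i))).1 h4]
    exact hS.triple_commutator_eq_one ht hb (hx i)

end Action

end LeftEngel

namespace LeftEngel

open scoped commutatorElement

/-! ### From sandwich sets to local nilpotency. -/

section Nilpotency

variable {G : Type*} [Group G]

lemma IsSandwichSet.image {H : Type*} [Group H] {S : Set G} (hS : IsSandwichSet S) {f : G →* H}
    (hf : Function.Surjective f) : IsSandwichSet (f '' S) := by
  refine ⟨⟨1, hS.one_mem, map_one f⟩, ?_, ?_, ?_⟩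
  · rintro _ ⟨a, ha, rfl⟩
    exact ⟨a⁻¹, hS.inv_mem ha, map_inv f a⟩
  · rintro _ ⟨a, ha, rfl⟩ h
    obtain ⟨g, rfl⟩ := hf h
    exact ⟨g * a * g⁻¹, hS.conj_mem ha g, by simp⟩
  · rintro _ _ _ ⟨c, hc, rfl⟩ ⟨g, hg, rfl⟩ ⟨h, hh, rfl⟩
    simpa using (hS.commute hc hg hh).map f

lemma IsSandwichSet.preimage {H : Type*} [Group H] {S : Set G} (hS : IsSandwichSet S) {f : H →* G}
    (hf : Function.Injective f) : IsSandwichSet (f ⁻¹' S) := by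
  refine ⟨?_, fun {a} ha => ?_, fun {a} ha g => ?_, fun {c g h} hc hg hh => ?_⟩
  · simpa using hS.one_mem
  · simpa using hS.inv_mem ha
  · simpa using hS.conj_mem ha (f g)
  · have := hS.commute hc hg hh
    rw [commute_iff_eq] at this ⊢
    apply hf
    simpa using this

/-- The commutators of an element with all elements of the group lie in a normal subgroup as soon
as this holds for generators. -/
lemma commutatorElement_mem_of_closure {X : Set G} (hX : Subgroup.closure X = ⊤) {N : Subgroup G}
    [N.Normal] {s : G} (h : ∀ x ∈ X, ⁅s, x⁆ ∈ N) (y : G) : ⁅s, y⁆ ∈ N := by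
  have hy : y ∈ Subgroup.closure X := hX ▸ Subgroup.mem_top y
  induction hy using Subgroup.closure_induction with
  | mem x hx => exact h x hx
  | one => simp [one_mem]
  | mul a b _ _ ha hb =>
    rw [commutatorElement_mul]
    exact mul_mem ha (Subgroup.Normal.conj_mem ‹_› _ hb a)
  | inv a _ ha =>
    have : ⁅s, a⁻¹⁆ = a⁻¹ * ⁅s, a⁆⁻¹ * a⁻¹⁻¹ := by simp only [commutatorElement_def]; group
    rw [this]
    exact Subgroup.Normal.conj_mem ‹_› _ (inv_mem ha) _

/-- A group generated by a finite subset of a sandwich set is nilpotent. -/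
theorem IsSandwichSet.isNilpotent_of_closure_eq_top {S : Set G} (hS : IsSandwichSet S) {X : Set G}
    (hfin : X.Finite) (hXS : X ⊆ S) (hX : Subgroup.closure X = ⊤) : Group.IsNilpotent G := by
  obtain ⟨T, hST, hT, hcl⟩ := hS.exists_commutator_closed
  obtain ⟨r, x, -, rfl⟩ := hfin.fin_param
  let Z : Subgroup G := ⨆ n, Subgroup.upperCentralSeries G n
  have hdir : Directed (· ≤ ·) (Subgroup.upperCentralSeries G) :=
    (Subgroup.upperCentralSeries_mono G).directed_le
  have hZmem : ∀ {g}, g ∈ Z ↔ ∃ n, g ∈ Subgroup.upperCentralSeries G n :=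
    Subgroup.mem_iSup_of_directed hdir
  have hZn : Z.Normal := ⟨fun n hn g => by
    obtain ⟨k, hk⟩ := hZmem.1 hn
    exact hZmem.2 ⟨k, Subgroup.Normal.conj_mem inferInstance n hk g⟩⟩
  have bound : ∀ f : Fin r → G, (∀ i, f i ∈ Z) →
      ∃ N, ∀ i, f i ∈ Subgroup.upperCentralSeries G N := by
    intro f hf
    choose k hk using fun i => hZmem.1 (hf i)
    obtain ⟨B, hB⟩ := (Set.finite_range k).bddAbove
    exact ⟨B, fun i => Subgroup.upperCentralSeries_mono G (hB ⟨i, rfl⟩) (hk i)⟩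
  let π := QuotientGroup.mk' Z
  have hπ : Function.Surjective π := QuotientGroup.mk'_surjective Z
  have hker : ∀ {g}, π g = 1 ↔ g ∈ Z := fun {g} => QuotientGroup.eq_one_iff g
  -- If `s` commutes with all generators modulo `Z`, its finitely many commutators with them lie in
  -- one term of the upper central series, so `s` lies in the next and is trivial modulo `Z`.
  have htriv := (hT.image hπ).eq_one_of_center (x := fun i => π (x i))
    (by
      rintro _ ⟨a, ha, rfl⟩ _ ⟨b, hb, rfl⟩
      exact ⟨⁅a, b⁆, hcl a ha b hb, map_commutatorElement π a b⟩)
    (fun i => ⟨x i, hST (hXS ⟨i, rfl⟩), rfl⟩)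
    (by
      rintro _ ⟨s, hs, rfl⟩ hcomm
      obtain ⟨N, hN⟩ := bound (fun i => ⁅s, x i⁆) fun i => by
        rw [← hker, map_commutatorElement]
        exact (hcomm i).commutator_eq
      refine hker.2 (hZmem.2 ⟨N + 1, Subgroup.mem_upperCentralSeries_succ_iff.2 ?_⟩)
      refine commutatorElement_mem_of_closure hX ?_
      rintro _ ⟨i, rfl⟩
      exact hN i)
  obtain ⟨N, hN⟩ := bound x fun i => hker.1 (htriv _ ⟨x i, hST (hXS ⟨i, rfl⟩), rfl⟩)
  refine ⟨N, top_le_iff.1 ?_⟩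
  rw [← hX, Subgroup.closure_le]
  rintro _ ⟨i, rfl⟩
  exact hN i

theorem IsSandwichSet.isNilpotent_closure {S : Set G} (hS : IsSandwichSet S) {X : Set G}
    (hfin : X.Finite) (hXS : X ⊆ S) : Group.IsNilpotent (Subgroup.closure X) := by
  refine (hS.preimage (f := (Subgroup.closure X).subtype)
    Subtype.val_injective).isNilpotent_of_closure_eq_top (X := Subtype.val ⁻¹' X)
    (hfin.preimage Subtype.val_injective.injOn) (fun x hx => hXS hx) ?_
  exact Subgroup.closure_closure_coe_preimage

lemma exists_finite_of_mem_closure {A : Set G} {g : G} (hg : g ∈ Subgroup.closure A) :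
    ∃ X ⊆ A, X.Finite ∧ g ∈ Subgroup.closure X := by
  induction hg using Subgroup.closure_induction with
  | mem x hx => exact ⟨{x}, by simpa using hx, Set.finite_singleton x,
      Subgroup.subset_closure rfl⟩
  | one => exact ⟨∅, Set.empty_subset _, Set.finite_empty, one_mem _⟩
  | mul a b _ _ ha hb =>
    obtain ⟨X, h1, h2, h3⟩ := ha
    obtain ⟨Y, h4, h5, h6⟩ := hb
    exact ⟨X ∪ Y, Set.union_subset h1 h4, h2.union h5,
      mul_mem (Subgroup.closure_mono Set.subset_union_left h3)
        (Subgroup.closure_mono Set.subset_union_right h6)⟩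
  | inv a _ ha =>
    obtain ⟨X, h1, h2, h3⟩ := ha
    exact ⟨X, h1, h2, inv_mem h3⟩

/-- Finitely many generators involve only finitely many elements of `S`, and these generate a
nilpotent group. -/
theorem IsSandwichSet.isLocallyNilpotent {S : Set G} (hS : IsSandwichSet S) {N : Subgroup G}
    (hN : N ≤ Subgroup.closure S) : IsLocallyNilpotent N := by
  intro H hH
  classical
  obtain ⟨F₀, hF₀⟩ := hH
  obtain ⟨F, hF⟩ : ∃ F : Finset G, Subgroup.closure (F : Set G) = H.map N.subtype :=
    ⟨F₀.image N.subtype, by rw [Finset.coe_image, ← MonoidHom.map_closure, hF₀]⟩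
  have hFS : ∀ g : F, ∃ X ⊆ S, X.Finite ∧ g.1 ∈ Subgroup.closure X := fun g => by
    have h1 : g.1 ∈ H.map N.subtype := hF ▸ Subgroup.subset_closure g.2
    obtain ⟨h, -, h2⟩ := h1
    exact exists_finite_of_mem_closure (hN (h2 ▸ h.2))
  choose X hXS hXfin hX using hFS
  have hle : H.map N.subtype ≤ Subgroup.closure (⋃ g, X g) := by
    rw [← hF, Subgroup.closure_le]
    intro g hg
    exact Subgroup.closure_mono (Set.subset_iUnion X ⟨g, hg⟩) (hX ⟨g, hg⟩)
  have hnil := hS.isNilpotent_closure (Set.finite_iUnion hXfin) (Set.iUnion_subset hXS)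
  obtain ⟨n, hn⟩ := (Subgroup.isNilpotent_iff_lowerCentralSeries _).1 hnil
  have : Group.IsNilpotent (H.map N.subtype) :=
    Subgroup.isNilpotent_of_lowerCentralSeries_eq_bot (n := n)
      (le_bot_iff.1 ((Subgroup.lowerCentralSeries_mono n hle).trans hn.le))
  exact Group.nilpotent_of_mulEquiv
    (H.equivMapOfInjective N.subtype Subtype.val_injective).symm

end Nilpotency

/-! ### Strong left 3-Engel elements. -/

section EngelElements

variable {G : Type*} [Group G]

/-- The conjugates of `a` and of its inverse, and the identity. -/
def conjugateSet (a : G) : Set G :=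
  {s | s = 1 ∨ ∃ g, s = g * a * g⁻¹ ∨ s = g * a⁻¹ * g⁻¹}

lemma conjugateSet_inv_mem {a s : G} (hs : s ∈ conjugateSet a) : s⁻¹ ∈ conjugateSet a := by
  rcases hs with rfl | ⟨g, rfl | rfl⟩
  · exact Or.inl inv_one
  · exact Or.inr ⟨g, Or.inr (by group)⟩
  · exact Or.inr ⟨g, Or.inl (by group)⟩

lemma conjugateSet_conj_mem {a s : G} (hs : s ∈ conjugateSet a) (h : G) :
    h * s * h⁻¹ ∈ conjugateSet a := by
  rcases hs with rfl | ⟨g, rfl | rfl⟩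
  · exact Or.inl (by group)
  · exact Or.inr ⟨h * g, Or.inl (by group)⟩
  · exact Or.inr ⟨h * g, Or.inr (by group)⟩

lemma self_mem_conjugateSet (a : G) : a ∈ conjugateSet a := Or.inr ⟨1, Or.inl (by group)⟩

lemma commute_conj_conj_of {a p g h : G}
    (H : Commute ((p⁻¹ * g * p⁻¹⁻¹) * a * (p⁻¹ * g * p⁻¹⁻¹)⁻¹)
      ((p⁻¹ * h * p⁻¹⁻¹) * a * (p⁻¹ * h * p⁻¹⁻¹)⁻¹)) :
    Commute (g * (p * a * p⁻¹) * g⁻¹) (h * (p * a * p⁻¹) * h⁻¹) := by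
  have := H.map (MulAut.conj p)
  simp only [MulAut.conj_apply] at this
  convert this using 1 <;> group

lemma isSandwichSet_conjugateSet {a : G}
    (h : ∀ b ∈ conjugateSet a, ∀ c ∈ conjugateSet a, Commute (b * a * b⁻¹) (c * a * c⁻¹)) :
    IsSandwichSet (conjugateSet a) := by
  refine ⟨Or.inl rfl, conjugateSet_inv_mem, conjugateSet_conj_mem, ?_⟩
  have key : ∀ p, ∀ b ∈ conjugateSet a, ∀ c ∈ conjugateSet a,
      Commute (b * (p * a * p⁻¹) * b⁻¹) (c * (p * a * p⁻¹) * c⁻¹) := fun p b hb c hc =>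
    commute_conj_conj_of
      (h _ (conjugateSet_conj_mem hb p⁻¹) _ (conjugateSet_conj_mem hc p⁻¹))
  rintro c g k (rfl | ⟨p, rfl | rfl⟩) hg hk
  · simp
  · exact key p g hg k hk
  · have := (key p g hg k hk).inv_inv
    convert this using 1 <;> group

lemma normalClosure_le_closure_conjugateSet (a : G) :
    Subgroup.normalClosure {a} ≤ Subgroup.closure (conjugateSet a) := by
  refine Subgroup.closure_mono ?_
  intro x hx
  simp only [Group.conjugatesOfSet, Set.mem_singleton_iff, Set.iUnion_iUnion_eq_left,
    conjugatesOf, Set.mem_ofPred_eq, isConj_iff] at hx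
  obtain ⟨g, rfl⟩ := hx
  exact Or.inr ⟨g, Or.inl rfl⟩

/-- The lower central series is indexed from 0, so term `n` is the last that can be nontrivial in
class `n + 1`, and it is central. -/
lemma commute_of_class_le {n : ℕ} {K : Subgroup G} (hK : NilpotentOfClassAtMost (n + 1) K)
    {x a : G} (hx : x ∈ K.lowerCentralSeries n) (ha : a ∈ K) : Commute x a := by
  have := hK.1
  have h := Subgroup.lowerCentralSeries_eq_bot_of_nilpotencyClass_le hK.2
  have hm : ⁅x, a⁆ ∈ K.lowerCentralSeries (n + 1) := Subgroup.commutator_mem_commutator hx ha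
  rw [h, Subgroup.mem_bot] at hm
  exact commutatorElement_eq_one_iff_commute.1 hm

lemma exists_mem_closure_of_mem_conjugateSet {a b : G} (hb : b ∈ conjugateSet a) :
    ∃ f, ∀ K : Subgroup G, groupConj a f ∈ K → b ∈ K := by
  rcases hb with rfl | ⟨g, rfl | rfl⟩
  · exact ⟨1, fun K _ => one_mem K⟩
  · exact ⟨g⁻¹, fun K h => by simpa [groupConj] using h⟩
  · refine ⟨g⁻¹, fun K h => ?_⟩
    have := inv_mem h
    simpa [groupConj, mul_assoc] using this

lemma IsStrongLeftThreeEngel.isSandwichSet {a : G} (ha : IsStrongLeftThreeEngel a) :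
    IsSandwichSet (conjugateSet a) := by
  have pair : ∀ b ∈ conjugateSet a, Commute a ⁅b, a⁆ := by
    intro b hb
    obtain ⟨f, hf⟩ := exists_mem_closure_of_mem_conjugateSet hb
    set K := Subgroup.closure {a, groupConj a f} with hKdef
    have haK : a ∈ K := Subgroup.subset_closure (by simp)
    have hbK : b ∈ K := hf K (Subgroup.subset_closure (by simp))
    exact (commute_of_class_le (n := 1) (ha.1 f)
      (Subgroup.commutator_mem_commutator hbK haK) haK).symm
  refine isSandwichSet_conjugateSet fun b hb c hc => ?_
  have hb' := conjugateSet_inv_mem hb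
  obtain ⟨f, hf⟩ := exists_mem_closure_of_mem_conjugateSet hb'
  obtain ⟨g, hg⟩ := exists_mem_closure_of_mem_conjugateSet hc
  set K := Subgroup.closure {a, groupConj a f, groupConj a g} with hKdef
  have haK : a ∈ K := Subgroup.subset_closure (by simp)
  have hbK : b⁻¹ ∈ K := hf K (Subgroup.subset_closure (by simp))
  have hcK : c ∈ K := hg K (Subgroup.subset_closure (by simp))
  have h2 : ⁅c, a⁆ ∈ K.lowerCentralSeries 1 := Subgroup.commutator_mem_commutator hcK haK
  have h3 : ⁅⁅c, a⁆, b⁻¹⁆ ∈ K.lowerCentralSeries 2 := Subgroup.commutator_mem_commutator h2 hbK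
  have c1 : Commute a ⁅⁅c, a⁆, b⁻¹⁆ := (commute_of_class_le (ha.2 f g) h3 haK).symm
  -- This product is the conjugate of `a` by b⁻¹c. Class 3 handles the triple commutator, class 2
  -- the two simple ones.
  have c2 : Commute a (⁅⁅c, a⁆, b⁻¹⁆⁻¹ * ⁅c, a⁆ * ⁅b⁻¹, a⁆ * a) :=
    ((c1.inv_right.mul_right (pair c hc)).mul_right (pair _ hb')).mul_right (Commute.refl a)
  rw [commute_conj_left_iff]
  convert c2 using 1
  simp only [commutatorElement_def]
  group

end EngelElements

end LeftEngel

namespace LeftEngel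

open scoped commutatorElement

/-! ### Left 3-Engel elements of odd order. -/

section OddOrder

variable {G : Type*} [Group G]

lemma eq_of_sq_eq_sq_of_odd {x y : G} {n : ℕ} (hn : Odd n) (hx : x ^ n = 1) (hy : y ^ n = 1)
    (h : x ^ 2 = y ^ 2) : x = y := by
  obtain ⟨k, rfl⟩ := hn
  have key : ∀ z : G, z ^ (2 * k + 1) = 1 → z = (z ^ 2) ^ (k + 1) := fun z hz => by
    rw [← pow_mul, show 2 * (k + 1) = (2 * k + 1) + 1 by ring, pow_succ, hz, one_mul]
  rw [key x hx, key y hy, h]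

/-- A set closed under inversion and conjugation, any two elements of which generate a subgroup of
class at most two. -/
structure IsWeakSandwichSet (S : Set G) : Prop where
  inv_mem : ∀ {a}, a ∈ S → a⁻¹ ∈ S
  conj_mem : ∀ {a}, a ∈ S → ∀ g, g * a * g⁻¹ ∈ S
  commute : ∀ {a b}, a ∈ S → b ∈ S → Commute a (b * a * b⁻¹)

namespace IsWeakSandwichSet

variable {S : Set G} (hS : IsWeakSandwichSet S)
include hS

lemma conj_mem' {a : G} (ha : a ∈ S) (g : G) : g⁻¹ * a * g ∈ S := by
  simpa using hS.conj_mem ha g⁻¹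

lemma commute_commutator_left {a b : G} (ha : a ∈ S) (hb : b ∈ S) : Commute a ⁅a, b⁆ := by
  rw [commutatorElement_eq_mul_conj_inv]
  exact (Commute.refl a).mul_right (hS.commute ha hb).inv_right

lemma commute_commutator_right {a b : G} (ha : a ∈ S) (hb : b ∈ S) : Commute b ⁅a, b⁆ := by
  rw [← commutatorElement_inv]
  exact (hS.commute_commutator_left hb ha).inv_right

lemma commutator_pow_eq_one {a b : G} (ha : a ∈ S) (hb : b ∈ S) {n : ℕ} (hn : a ^ n = 1) :
    ⁅a, b⁆ ^ n = 1 := by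
  rw [commutatorElement_eq_mul_conj_inv, (hS.commute ha hb).inv_right.mul_pow, inv_pow, conj_pow,
    hn]
  group

/-- If `e` commutes with `a`, the commutator of `a` with `e` conjugated by the powers of `b`
depends linearly on the exponent. -/
lemma commutator_conj_pow {a b e : G} (ha : a ∈ S) (hb : b ∈ S) (he : e ∈ S) (hae : Commute a e) :
    ⁅a, (b * b) * e * (b * b)⁻¹⁆ = ⁅a, b * e * b⁻¹⁆ ^ 2 ∧
      ⁅a, b⁻¹ * e * b⁆ = ⁅a, b * e * b⁻¹⁆⁻¹ := by
  set w := ⁅b, e⁆ with hw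
  have wb : Commute b w := hS.commute_commutator_left hb he
  have we : Commute e w := hS.commute_commutator_right hb he
  have e1 : b * e * b⁻¹ = w * e := by rw [hw, commutatorElement_def]; group
  have e2 : (b * b) * e * (b * b)⁻¹ = w * w * e := by
    calc (b * b) * e * (b * b)⁻¹ = b * (b * e * b⁻¹) * b⁻¹ := by group
      _ = b * (w * e) * b⁻¹ := by rw [e1]
      _ = (b * w * b⁻¹) * (b * e * b⁻¹) := by group
      _ = _ := by rw [conj_eq_self_of_commute wb, e1, mul_assoc]
  have e3 : b⁻¹ * e * b = w⁻¹ * e := by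
    have : e = b⁻¹ * w * b⁻¹⁻¹ * (b⁻¹ * e * b) := by
      calc e = b⁻¹ * (b * e * b⁻¹) * b := by group
        _ = _ := by rw [e1]; group
    rw [conj_eq_self_of_commute wb.inv_left] at this
    rw [eq_inv_mul_iff_mul_eq]
    exact this.symm
  have drop : ∀ z, ⁅a, z * e⁆ = ⁅a, z⁆ := fun z => by
    rw [commutatorElement_mul, hae.commutator_eq]; group
  -- `w * e` is a conjugate of `e`, hence in `S`. Since `e` commutes with [a,w], so does `w`, which
  -- makes the exponent linear.
  have hq : Commute (w * e) ⁅a, w * e⁆ := by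
    rw [← e1]
    exact hS.commute_commutator_right ha (hS.conj_mem he b)
  have hqe : Commute e ⁅a, w⁆ := by
    rw [commutatorElement_def]
    exact ((hae.symm.mul_right we).mul_right hae.symm.inv_right).mul_right we.inv_right
  have hqw : Commute w ⁅a, w⁆ := by
    rw [drop] at hq
    have := hq.mul_left hqe.inv_left
    rwa [mul_inv_cancel_right] at this
  rw [e1, e2, e3, drop, drop, drop]
  constructor
  · rw [commutatorElement_mul, conj_eq_self_of_commute hqw, pow_two]
  · have : ⁅a, w⁻¹⁆ = w⁻¹ * ⁅a, w⁆⁻¹ * w⁻¹⁻¹ := by simp only [commutatorElement_def]; group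
    rw [this, conj_eq_self_of_commute hqw.inv_left.inv_right]

variable {a : G} (ha : a ∈ S) {n : ℕ} (hn : Odd n) (han : a ^ n = 1)
include ha

lemma pairing_sq {b c : G} (hb : b ∈ S) (hc : c ∈ S) :
    ⁅a, (b * b * c) * a * (b * b * c)⁻¹⁆ = ⁅a, (b * c) * a * (b * c)⁻¹⁆ ^ 2 := by
  have := (hS.commutator_conj_pow ha hb (hS.conj_mem ha c) (hS.commute ha hc)).1
  convert this using 2
  · group
  · congr 1; group

lemma pairing_inv {b c : G} (hb : b ∈ S) (hc : c ∈ S) :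
    ⁅a, (b⁻¹ * c) * a * (b⁻¹ * c)⁻¹⁆ = ⁅a, (b * c) * a * (b * c)⁻¹⁆⁻¹ := by
  have := (hS.commutator_conj_pow ha hb (hS.conj_mem ha c) (hS.commute ha hc)).2
  convert this using 2
  · group
  · congr 1; group

include han

lemma pairing_pow_eq_one (h : G) : ⁅a, h * a * h⁻¹⁆ ^ n = 1 :=
  hS.commutator_pow_eq_one ha (hS.conj_mem ha h) han

include hn

/-- It suffices to compare squares. With b' = c⁻¹bc and c' = b⁻²cb² one has b'c' = cb and b'b'c' =
bbc, so `pairing_sq` gives both squares the same value. -/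
lemma pairing_comm {b c : G} (hb : b ∈ S) (hc : c ∈ S) :
    ⁅a, (b * c) * a * (b * c)⁻¹⁆ = ⁅a, (c * b) * a * (c * b)⁻¹⁆ := by
  refine eq_of_sq_eq_sq_of_odd hn (hS.pairing_pow_eq_one ha han _)
    (hS.pairing_pow_eq_one ha han _) ?_
  have hb' : c⁻¹ * b * c ∈ S := hS.conj_mem' hb c
  have hc' : (b * b)⁻¹ * c * (b * b) ∈ S := hS.conj_mem' hc _
  obtain ⟨k, hk⟩ : ∃ k, k = (b * c)⁻¹ * (c * b) := ⟨_, rfl⟩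
  have kb : Commute b k := by
    have h1 : Commute b (c⁻¹ * b * c) := by simpa using hS.commute hb (hS.inv_mem hc)
    have h2 : k = (c⁻¹ * b * c)⁻¹ * b := by rw [hk]; group
    exact h2 ▸ h1.inv_right.mul_right (Commute.refl b)
  have kc : Commute c k := by
    have h1 : Commute c (b⁻¹ * c * b) := by simpa using hS.commute hc (hS.inv_mem hb)
    have h2 : k = c⁻¹ * (b⁻¹ * c * b) := by rw [hk]; group
    exact h2 ▸ (Commute.refl c).inv_right.mul_right h1
  have hcb : c * b = b * c * k := by rw [hk]; group
  have e3 : c⁻¹ * b * c = b * k⁻¹ := by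
    rw [eq_mul_inv_iff_mul_eq, mul_assoc, mul_assoc, ← mul_assoc b, ← hcb, inv_mul_cancel_left]
  have e4 : (b * b)⁻¹ * c * (b * b) = c * k * k := by
    calc (b * b)⁻¹ * c * (b * b) = b⁻¹ * (b⁻¹ * (c * b)) * b := by group
      _ = b⁻¹ * (c * (k * b)) := by rw [hcb]; group
      _ = b⁻¹ * (c * b) * k := by rw [← kb.eq]; group
      _ = c * k * k := by rw [hcb]; group
  have e1 : c⁻¹ * b * c * ((b * b)⁻¹ * c * (b * b)) = c * b := by
    calc c⁻¹ * b * c * ((b * b)⁻¹ * c * (b * b)) = b * (k⁻¹ * c) * k * k := by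
          rw [e3, e4]; group
      _ = c * b := by rw [← kc.inv_right.eq, hcb]; group
  have e2 : c⁻¹ * b * c * (c⁻¹ * b * c) * ((b * b)⁻¹ * c * (b * b)) = b * b * c := by
    calc c⁻¹ * b * c * (c⁻¹ * b * c) * ((b * b)⁻¹ * c * (b * b)) =
          b * k⁻¹ * (c⁻¹ * b * c * ((b * b)⁻¹ * c * (b * b))) := by rw [← e3]; group
      _ = b * (k⁻¹ * (b * c)) * k := by rw [e1, hcb]; group
      _ = b * b * c := by rw [← (kb.mul_left kc).inv_right.eq]; group
  rw [← hS.pairing_sq ha hb hc, ← e1, ← hS.pairing_sq ha hb' hc', e2]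

lemma pairing_conj {b c : G} (hb : b ∈ S) (hc : c ∈ S) :
    ⁅a, (b * (b⁻¹ * c * b)) * a * (b * (b⁻¹ * c * b))⁻¹⁆ = ⁅a, (b * c) * a * (b * c)⁻¹⁆ := by
  rw [hS.pairing_comm ha hn han hb hc]
  congr 1
  group

lemma pairing_inv_inv {b c : G} (hb : b ∈ S) (hc : c ∈ S) :
    ⁅a, (b⁻¹ * c⁻¹) * a * (b⁻¹ * c⁻¹)⁻¹⁆ = ⁅a, (b * c) * a * (b * c)⁻¹⁆ := by
  rw [hS.pairing_inv ha hb (hS.inv_mem hc), hS.pairing_comm ha hn han hb (hS.inv_mem hc),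
    hS.pairing_inv ha hc hb, inv_inv, hS.pairing_comm ha hn han hc hb]

lemma pairing_sq' {b c : G} (hb : b ∈ S) (hc : c ∈ S) :
    ⁅a, (c * (b * b)) * a * (c * (b * b))⁻¹⁆ = ⁅a, (b * c) * a * (b * c)⁻¹⁆ ^ 2 := by
  have hc1 : b⁻¹ * c * b ∈ S := hS.conj_mem' hc b
  have hc2 : b⁻¹ * (b⁻¹ * c * b) * b ∈ S := hS.conj_mem' hc1 b
  rw [← hS.pairing_conj ha hn han hb hc, ← hS.pairing_conj ha hn han hb hc1,
    ← hS.pairing_sq ha hb hc2]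
  congr 1
  group

omit ha hn han hS in
lemma pairing_inv_conj (h : G) :
    h * ⁅a, h⁻¹ * a * h⁻¹⁻¹⁆ * h⁻¹ = ⁅a, h * a * h⁻¹⁆⁻¹ := by
  simp only [commutatorElement_def]; group

/-- The pairing takes the same value at bc and at its inverse, while conjugation by bc carries the
latter to the inverse of the former. -/
lemma pairing_conj_self {b c : G} (hb : b ∈ S) (hc : c ∈ S) :
    (b * c) * ⁅a, (b * c) * a * (b * c)⁻¹⁆ * (b * c)⁻¹ = ⁅a, (b * c) * a * (b * c)⁻¹⁆⁻¹ := by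
  have h : ⁅a, (b * c)⁻¹ * a * (b * c)⁻¹⁻¹⁆ = ⁅a, (b * c) * a * (b * c)⁻¹⁆ := by
    rw [mul_inv_rev, hS.pairing_inv_inv ha hn han hc hb, hS.pairing_comm ha hn han hc hb,
      mul_inv_rev]
  rw [← pairing_inv_conj, h]

/-- The value y is inverted by bc, and y² is inverted by bbc; odd order removes the square, so `b`
itself must fix y. -/
lemma pairing_conj_left {b c : G} (hb : b ∈ S) (hc : c ∈ S) :
    b * ⁅a, (b * c) * a * (b * c)⁻¹⁆ * b⁻¹ = ⁅a, (b * c) * a * (b * c)⁻¹⁆ := by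
  have h1 := hS.pairing_conj_self ha hn han hb hc
  have h2 : (b * b * c) * ⁅a, (b * c) * a * (b * c)⁻¹⁆ ^ 2 * (b * b * c)⁻¹ =
      (⁅a, (b * c) * a * (b * c)⁻¹⁆ ^ 2)⁻¹ := by
    rw [← hS.pairing_sq ha hb hc, ← pairing_inv_conj]
    congr 2
    rw [hS.pairing_sq ha hb hc, ← hS.pairing_inv_inv ha hn han hb hc,
      ← hS.pairing_sq' ha hn han (hS.inv_mem hb) (hS.inv_mem hc)]
    congr 1
    group
  set y := ⁅a, (b * c) * a * (b * c)⁻¹⁆ with hy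
  have hyn : y ^ n = 1 := hS.pairing_pow_eq_one ha han _
  have h3 : (b * b * c) * y * (b * b * c)⁻¹ = y⁻¹ := by
    refine eq_of_sq_eq_sq_of_odd hn ?_ ?_ ?_
    · rw [conj_pow, hyn]; group
    · rw [inv_pow, hyn, inv_one]
    · rw [conj_pow, h2, inv_pow]
  have h4 : b * y⁻¹ * b⁻¹ = y⁻¹ := by
    calc b * y⁻¹ * b⁻¹ = (b * b * c) * y * (b * b * c)⁻¹ := by rw [← h1]; group
      _ = y⁻¹ := h3
  have := congrArg (·⁻¹) h4
  simpa [mul_assoc] using this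

theorem pairing_eq_one {b c : G} (hb : b ∈ S) (hc : c ∈ S) :
    ⁅a, (b * c) * a * (b * c)⁻¹⁆ = 1 := by
  have h1 := hS.pairing_conj_self ha hn han hb hc
  have h2 := hS.pairing_conj_left ha hn han hb hc
  have h3 := hS.pairing_conj_left ha hn han hc hb
  rw [← hS.pairing_comm ha hn han hb hc] at h3
  have hyn := hS.pairing_pow_eq_one ha han (b * c)
  set y := ⁅a, (b * c) * a * (b * c)⁻¹⁆ with hy
  have h4 : (b * c) * y * (b * c)⁻¹ = y := by
    calc (b * c) * y * (b * c)⁻¹ = b * (c * y * c⁻¹) * b⁻¹ := by group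
      _ = y := by rw [h3, h2]
  have h5 : y = y⁻¹ := h4.symm.trans h1
  refine eq_of_sq_eq_sq_of_odd hn hyn (one_pow n) ?_
  rw [one_pow, pow_two]
  nth_rewrite 2 [h5]
  exact mul_inv_cancel y

theorem commute_conj_conj {b c : G} (hb : b ∈ S) (hc : c ∈ S) :
    Commute (b * a * b⁻¹) (c * a * c⁻¹) := by
  rw [commute_conj_left_iff, ← commutatorElement_eq_one_iff_commute,
    ← hS.pairing_eq_one ha hn han (hS.inv_mem hb) hc]
  congr 1
  group

end IsWeakSandwichSet

lemma IsLeftEngel.commute_conj {a : G} (ha : IsLeftEngel 3 a) (g : G) :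
    Commute a ((g * a * g⁻¹) * a * (g * a * g⁻¹)⁻¹) := by
  have h := ha g⁻¹
  set u := groupComm (groupComm g⁻¹ a) a with hu
  have hau : Commute a u := by
    have h' : u⁻¹ * a⁻¹ * u * a = 1 := h
    rw [commute_iff_eq]
    calc a * u = a * u * (u⁻¹ * a⁻¹ * u * a) := by rw [h', mul_one]
      _ = u * a := by group
  -- The Engel condition at x = g⁻¹ says that `a` commutes with `u`, and this conjugate is a word in
  -- `a` and `u`.
  have e : (g * a * g⁻¹) * a * (g * a * g⁻¹)⁻¹ = a * a * u⁻¹ * a⁻¹ := by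
    rw [hu]; simp only [groupComm]; group
  rw [e]
  exact (((Commute.refl a).mul_right (Commute.refl a)).mul_right hau.inv_right).mul_right
    (Commute.refl a).inv_right

lemma IsLeftEngel.isWeakSandwichSet {a : G} (ha : IsLeftEngel 3 a) :
    IsWeakSandwichSet (conjugateSet a) := by
  refine ⟨conjugateSet_inv_mem, conjugateSet_conj_mem, ?_⟩
  have base : ∀ b ∈ conjugateSet a, Commute a (b * a * b⁻¹) := by
    rintro b (rfl | ⟨g, rfl | rfl⟩)
    · simp
    · exact ha.commute_conj g
    · have := ha.commute_conj g
      rw [Commute.symm_iff, commute_conj_left_iff] at this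
      convert this using 1
      group
  have key : ∀ p, ∀ b ∈ conjugateSet a, Commute (p * a * p⁻¹) (b * (p * a * p⁻¹) * b⁻¹) := by
    intro p b hb
    have := (base _ (conjugateSet_conj_mem hb p⁻¹)).map (MulAut.conj p)
    simp only [MulAut.conj_apply] at this
    convert this using 1
    group
  rintro x b (rfl | ⟨p, rfl | rfl⟩) hb
  · simp
  · exact key p b hb
  · have := (key p b hb).inv_inv
    convert this using 1 <;> group

/-- An element of infinite order has `orderOf` equal to 0, which is even, so `hodd` includes
finiteness. -/
lemma IsLeftEngel.isSandwichSet {a : G} (ha : IsLeftEngel 3 a) (hodd : Odd (orderOf a)) :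
    IsSandwichSet (conjugateSet a) :=
  isSandwichSet_conjugateSet fun _ hb _ hc => ha.isWeakSandwichSet.commute_conj_conj
    (self_mem_conjugateSet a) hodd (pow_orderOf_eq_one a) hb hc

end OddOrder

end LeftEngel

theorem theorem2p3 {G : Type*} [Group G] :
    (∀ a : G, LeftEngel.IsStrongLeftThreeEngel a →
      LeftEngel.IsLocallyNilpotent (Subgroup.normalClosure ({a} : Set G))) ∧
    (∀ a : G, LeftEngel.IsLeftEngel 3 a → Odd (orderOf a) →
      a ∈ LeftEngel.hirschPlotkinRadical G) := by
  refine ⟨fun a ha => ha.isSandwichSet.isLocallyNilpotent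
    (LeftEngel.normalClosure_le_closure_conjugateSet a), fun a ha hodd => ?_⟩
  have hN : Subgroup.normalClosure ({a} : Set G) ≤ LeftEngel.hirschPlotkinRadical G :=
    le_sSup ⟨Subgroup.normalClosure_normal, (ha.isSandwichSet hodd).isLocallyNilpotent
      (LeftEngel.normalClosure_le_closure_conjugateSet a)⟩
  exact hN (Subgroup.subset_normalClosure rfl)
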